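/- \textbf{Theorem (slow switching).} Let $E=\{0,1,\dots,n-1\}$, let $Q$ be an irreducible generator matrix on $E$ (nonnegative off-diagonal entries, rows summing to $0$), and let $\{A_i\}_{i\in E}$ be real $d\times d$ matrices. Assume that every $A_i$ is Hurwitz, i.e. all of its complex eigenvalues have strictly negative real part. Then there is a constant $a>0$, depending only on $Q$ and $\{A_i\}_{i\in E}$, such that the following holds for every switching rate $r$ with $0<r<a$. Let $(I_t)_{t\ge 0}$ be any Markov process on $E$ with generator $rQ$ and right-continuous paths, and let $(X_t)_{t\ge0}$ be the $\mathbb{R}^d$-valued process solving $$X_t = X_0+\int_0^t A_{I_s}X_s\,ds\qquad (t\ge 0),$$ where the initial condition $(X_0,I_0)$ has an arbitrary distribution on $\mathbb{R}^d\times E$ with $\mathbb{E}\|X_0\|<\infty$. Then $\|X_t\|\to 0$ as $t\to\infty$ almost surely. -/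

import Mathlib

open MeasureTheory Filter Topology

/-- A real square matrix is Hurwitz if all of its (complex) eigenvalues have strictly negative
real part. -/
def IsHurwitz {d : ℕ} (A : Matrix (Fin d) (Fin d) ℝ) : Prop :=
  ∀ z ∈ spectrum ℂ (A.map (algebraMap ℝ ℂ)), z.re < 0

/-- Generator matrices (Q-matrices) of Markov processes on `Fin n`: the off-diagonal entries are
nonnegative and every row sums to zero. -/
structure IsGeneratorMatrix {n : ℕ} (Q : Matrix (Fin n) (Fin n) ℝ) : Prop where
  nonneg : ∀ i j, i ≠ j → 0 ≤ Q i j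
  row_sum : ∀ i, ∑ j, Q i j = 0

/-- Irreducibility of a generator matrix: each state can be reached from each state through
finitely many jumps of positive rate. (The diagonal entries of a generator matrix are never
positive, so they play no role.) -/
def IsIrreducibleGenerator {n : ℕ} (Q : Matrix (Fin n) (Fin n) ℝ) : Prop :=
  ∀ i j, Relation.ReflTransGen (fun k l => 0 < Q k l) i j

/-- `(I t)`, `t ≥ 0`, is a (time-homogeneous, continuous-time) Markov process on `Fin n` with
generator `G`: it has the finite-dimensional distributions of the Markov process with transition
semigroup `exp (t G)` and with the law of `I 0` as its initial law, and its paths are almost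
surely right-continuous (for the discrete topology). The initial law is arbitrary. Values of `I`
at negative times are irrelevant. -/
structure IsMarkovProcess {n : ℕ} {Ω : Type*} [MeasurableSpace Ω] (μ : Measure Ω)
    (G : Matrix (Fin n) (Fin n) ℝ) (I : ℝ → Ω → Fin n) : Prop where
  measurable : ∀ t, 0 ≤ t → Measurable (I t)
  finite_dim : ∀ (m : ℕ) (t : ℕ → ℝ) (i : ℕ → Fin n), 0 ≤ t 0 → Monotone t →
    μ.real {ω | ∀ k ≤ m, I (t k) ω = i k} =
      μ.real {ω | I (t 0) ω = i 0} *
        ∏ k ∈ Finset.range m, NormedSpace.exp ((t (k + 1) - t k) • G) (i k) (i (k + 1))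
  right_continuous : ∀ᵐ ω ∂μ, ∀ t, 0 ≤ t → ∀ᶠ s in 𝓝[>] t, I s ω = I t ω

/-- `x` solves `x t = x 0 + ∫₀ᵗ A_{e s} x s ds` for all `t ≥ 0`, for the switching path `e`. -/
def IsSwitchedSolution {n d : ℕ} (A : Fin n → Matrix (Fin d) (Fin d) ℝ)
    (e : ℝ → Fin n) (x : ℝ → EuclideanSpace ℝ (Fin d)) : Prop :=
  ∀ t, 0 ≤ t →
    IntervalIntegrable (fun s => Matrix.toEuclideanLin (A (e s)) (x s)) volume 0 t ∧
      x t = x 0 + ∫ s in (0 : ℝ)..t, Matrix.toEuclideanLin (A (e s)) (x s)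

/-!
While the switching path rests in a state `i`, the solution follows the linear flow of the Hurwitz
matrix `A i`, which decays exponentially. Measured in the norm `sup_{s ≥ 0} e^{lam s} ‖e^{s A i} x‖`
(`adaptedNorm`) it decays at rate `lam` without any multiplicative constant, and passing from the
norm of one state to that of another costs at most a fixed factor `K`. A path with `N` changes of
state up to time `t` therefore gives `‖X_t‖ ≤ K ^ N e^{-lam t}` times a norm of `X_0`
(`IsSwitchedSolution.le_of_growth`). Switching is slow if `K ^ N` is almost surely of smaller
exponential order than `e^{lam t}`.

The changes are counted along grids of mesh `1 / (k + 1)`. There the finite-dimensional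
distributions apply: in each time step of length `h` the state changes with conditional
probability at most `r b h`, with `b` depending on `Q` only, so that by induction over the steps
the expectation of `K ^ N` is at most `(1 + (K - 1) r b h) ^ (t / h) ≤ e^{(K - 1) r b t}`
(`IsMarkovProcess.lintegral_pow_numChanges_le`). By Fatou's lemma the lower limit as `k → ∞`,
called `gridGrowth`, obeys the same bound (`IsMarkovProcess.lintegral_gridGrowth_le`). The path
estimate needs only two properties of this lower limit: it is nondecreasing in time, and it gains a
factor `K` between any two times at which the path is in different states, because by
right-continuity the path agrees at both times with its values at nearby grid points
(`one_add_mul_gridGrowth_le`). In particular no jump times have to be constructed.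

If `(K - 1) r b < lam / 2`, the expectations of `e^{-lam m / 2} gridGrowth m` are summable over the
integers `m`, so `gridGrowth` is almost surely `O(e^{lam m / 2})` and the solution tends to `0`.

The exponential decay of the flow of a Hurwitz matrix (`Matrix.exists_norm_exp_smul_le`) is
obtained from Gelfand's formula: every eigenvalue of `e^M` is `e^z` for an eigenvalue `z` of `M`,
so the spectral radius of `e^M` is less than `1`.
-/

/-! ### Exponential decay of the semigroup of a Hurwitz matrix -/

section Hurwitz

open scoped Matrix.Norms.L2Operator

variable {d : ℕ}

lemma Matrix.exp_mulVec_eq_smul {M : Matrix (Fin d) (Fin d) ℂ} {z : ℂ} {w : Fin d → ℂ}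
    (h : M.mulVec w = z • w) : (NormedSpace.exp M).mulVec w = Complex.exp z • w := by
  have hpow : ∀ k : ℕ, (M ^ k).mulVec w = z ^ k • w := by
    intro k
    induction k with
    | zero => simp
    | succ k ih => rw [pow_succ', ← Matrix.mulVec_mulVec, ih, Matrix.mulVec_smul, h, smul_smul,
        pow_succ]
  have h1 := NormedSpace.exp_series_hasSum_exp' (𝕂 := ℂ) M
  have h2 := NormedSpace.exp_series_hasSum_exp' (𝕂 := ℂ) z
  let L : Matrix (Fin d) (Fin d) ℂ →ₗ[ℂ] (Fin d → ℂ) :=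
    { toFun := fun N => N.mulVec w
      map_add' := fun a b => Matrix.add_mulVec a b w
      map_smul' := fun c a => Matrix.smul_mulVec c a w }
  have h3 := h1.mapL L.toContinuousLinearMap
  have h4 := h2.smul_const w
  rw [← Complex.exp_eq_exp_ℂ] at h4
  have hterm : (fun k : ℕ => L.toContinuousLinearMap ((k.factorial⁻¹ : ℂ) • M ^ k))
      = fun k : ℕ => ((k.factorial⁻¹ : ℂ) • z ^ k) • w := by
    funext k
    change ((_ : ℂ) • M ^ k).mulVec w = _
    rw [Matrix.smul_mulVec, hpow, smul_smul, smul_eq_mul]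
  rw [hterm] at h3
  exact h3.unique h4

/-- The nontrivial inclusion of the spectral mapping theorem for the exponential. An eigenspace
of `exp M` is invariant under `M`, so it contains an eigenvector of `M`. -/
lemma Matrix.exists_spectrum_exp_eq {M : Matrix (Fin d) (Fin d) ℂ} {m : ℂ}
    (hm : m ∈ spectrum ℂ (NormedSpace.exp M)) : ∃ z ∈ spectrum ℂ M, Complex.exp z = m := by
  rw [← Matrix.spectrum_toLin', ← Module.End.hasEigenvalue_iff_mem_spectrum] at hm
  set W := Module.End.eigenspace (Matrix.toLin' (NormedSpace.exp M)) m with hW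
  have hcomm : Commute M (NormedSpace.exp M) := (Commute.refl M).exp_right
  have hinv : ∀ w ∈ W, Matrix.toLin' M w ∈ W := by
    intro w hw
    rw [hW, Module.End.mem_eigenspace_iff] at hw ⊢
    simp only [Matrix.toLin'_apply] at hw ⊢
    rw [Matrix.mulVec_mulVec, ← hcomm.eq, ← Matrix.mulVec_mulVec, hw, Matrix.mulVec_smul]
  have : Nontrivial W := Submodule.nontrivial_iff_ne_bot.2 hm
  obtain ⟨z, hz⟩ := Module.End.exists_eigenvalue ((Matrix.toLin' M).restrict hinv)
  obtain ⟨w, hw⟩ := hz.exists_hasEigenvector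
  have hw0 : (w : Fin d → ℂ) ≠ 0 := fun h => hw.2 (Subtype.ext h)
  have hMw : M.mulVec (w : Fin d → ℂ) = z • (w : Fin d → ℂ) := by
    have := congrArg Subtype.val hw.apply_eq_smul
    simpa using this
  refine ⟨z, ?_, ?_⟩
  · rw [← Matrix.spectrum_toLin', ← Module.End.hasEigenvalue_iff_mem_spectrum]
    exact Module.End.hasEigenvalue_of_hasEigenvector
      (Module.End.hasEigenvector_iff.2 ⟨Module.End.mem_eigenspace_iff.2 (by simpa using hMw), hw0⟩)
  · have h1 := Matrix.exp_mulVec_eq_smul hMw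
    have h2 := Module.End.mem_eigenspace_iff.1 w.2
    rw [Matrix.toLin'_apply, h1] at h2
    exact smul_left_injective ℂ hw0 h2

/-- A function that decreases along steps of length `k > 0` and is bounded on `[0, k]` is bounded
on `[0, ∞)`. -/
lemma le_of_forall_add_le {g : ℝ → ℝ} {k B : ℝ} (hk : 0 < k)
    (hstep : ∀ t, 0 ≤ t → g (t + k) ≤ g t) (hB : ∀ t ∈ Set.Icc 0 k, g t ≤ B) {t : ℝ}
    (ht : 0 ≤ t) : g t ≤ B := by
  have key : ∀ m : ℕ, ∀ t, 0 ≤ t → t ≤ m * k → g t ≤ B := by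
    intro m
    induction m with
    | zero =>
      intro t h0 h1
      exact hB t ⟨h0, by simp at h1; linarith⟩
    | succ m ih =>
      intro t h0 h1
      rcases le_total t k with h | h
      · exact hB t ⟨h0, h⟩
      · have := hstep (t - k) (by linarith)
        rw [sub_add_cancel] at this
        exact this.trans (ih _ (by linarith) (by push_cast at h1; linarith))
  obtain ⟨m, hm⟩ := exists_nat_ge (t / k)
  exact key m t ht ((div_le_iff₀ hk).1 hm)

/-- If all eigenvalues of a complex matrix lie in the open left half-plane, then its semigroup
decays exponentially: some power of `exp M` is a contraction by Gelfand's formula. -/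
lemma Matrix.exists_norm_exp_smul_le {M : Matrix (Fin d) (Fin d) ℂ}
    (hM : ∀ z ∈ spectrum ℂ M, z.re < 0) :
    ∃ lam : ℝ, 0 < lam ∧ ∃ C : ℝ, ∀ t : ℝ, 0 ≤ t →
      ‖NormedSpace.exp (t • M)‖ ≤ C * Real.exp (-lam * t) := by
  rcases subsingleton_or_nontrivial (Matrix (Fin d) (Fin d) ℂ) with hs | hn
  · refine ⟨1, one_pos, 0, fun t _ => ?_⟩
    rw [Subsingleton.elim (NormedSpace.exp (t • M)) 0]
    simp
  have hrad : spectralRadius ℂ (NormedSpace.exp M) < (1 : NNReal) := by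
    refine spectrum.spectralRadius_lt_of_forall_lt _ fun m hm => ?_
    obtain ⟨z, hz, rfl⟩ := Matrix.exists_spectrum_exp_eq hm
    rw [← NNReal.coe_lt_coe, coe_nnnorm, Complex.norm_exp, NNReal.coe_one, Real.exp_lt_one_iff]
    exact hM z hz
  obtain ⟨k, hk0, hk⟩ : ∃ k : ℕ, 0 < k ∧ ‖NormedSpace.exp M ^ k‖ < 1 := by
    have h1 := spectrum.pow_nnnorm_pow_one_div_tendsto_nhds_spectralRadius (NormedSpace.exp M)
    obtain ⟨k, hk, hk0⟩ := ((h1.eventually_lt_const hrad).and (eventually_gt_atTop 0)).exists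
    refine ⟨k, hk0, ?_⟩
    by_contra hcon
    rw [not_lt] at hcon
    have : (1 : ENNReal) ≤ (‖NormedSpace.exp M ^ k‖₊ : ENNReal) := by
      exact_mod_cast hcon
    exact absurd hk (not_lt.2 (by simpa using ENNReal.one_le_rpow this (by positivity)))
  have hkR : (0 : ℝ) < k := by exact_mod_cast hk0
  set q : ℝ := max ‖NormedSpace.exp M ^ k‖ (1 / 2) with hq
  have hq0 : 0 < q := lt_max_of_lt_right (by norm_num)
  have hq1 : q < 1 := max_lt hk (by norm_num)
  set lam : ℝ := -Real.log q / k with hlam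
  have hlog : Real.log q < 0 := Real.log_neg hq0 hq1
  have hlam0 : 0 < lam := div_pos (by linarith) hkR
  have hexp : Real.exp (lam * k) = q⁻¹ := by
    rw [hlam, div_mul_cancel₀ _ hkR.ne', Real.exp_neg, Real.exp_log hq0]
  have hcont : Continuous fun t : ℝ => Real.exp (lam * t) * ‖NormedSpace.exp (t • M)‖ := by
    let _ := NormedAlgebra.restrictScalars ℚ ℂ (Matrix (Fin d) (Fin d) ℂ)
    have : Continuous fun t : ℝ => NormedSpace.exp (t • M) :=
      NormedSpace.exp_continuous.comp (by fun_prop)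
    fun_prop
  obtain ⟨C, hC⟩ := (isCompact_Icc (a := (0 : ℝ)) (b := k)).bddAbove_image hcont.continuousOn
  refine ⟨lam, hlam0, C, fun t ht => ?_⟩
  have := le_of_forall_add_le (g := fun t : ℝ => Real.exp (lam * t) * ‖NormedSpace.exp (t • M)‖)
    (B := C) hkR ?_ (fun t ht => hC ⟨t, ht, rfl⟩) ht
  · rw [neg_mul, Real.exp_neg, ← div_eq_mul_inv, le_div_iff₀ (Real.exp_pos _), mul_comm]
    exact this
  · intro t _
    have h1 : NormedSpace.exp ((t + k) • M) = NormedSpace.exp (t • M) * NormedSpace.exp M ^ k := by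
      rw [add_smul, Matrix.exp_add_of_commute _ _
        (((Commute.refl M).smul_left _).smul_right _), ← Matrix.exp_nsmul, Nat.cast_smul_eq_nsmul]
    have h2 : ‖NormedSpace.exp ((t + k) • M)‖ ≤ ‖NormedSpace.exp (t • M)‖ * q := by
      rw [h1]
      exact (norm_mul_le _ _).trans
        (mul_le_mul_of_nonneg_left (le_max_left _ _) (norm_nonneg _))
    calc Real.exp (lam * (t + k)) * ‖NormedSpace.exp ((t + k) • M)‖
        ≤ Real.exp (lam * (t + k)) * (‖NormedSpace.exp (t • M)‖ * q) := by gcongr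
      _ = Real.exp (lam * t) * ‖NormedSpace.exp (t • M)‖ := by
          rw [mul_add, Real.exp_add, hexp]
          field_simp

/-- A real matrix acts on real vectors as its complexification does, and complexifying a real
vector does not change its Euclidean norm. -/
lemma Matrix.norm_toEuclideanCLM_apply_le_norm_map (B : Matrix (Fin d) (Fin d) ℝ)
    (x : EuclideanSpace ℝ (Fin d)) :
    ‖Matrix.toEuclideanCLM (𝕜 := ℝ) B x‖ ≤ ‖B.map (algebraMap ℝ ℂ)‖ * ‖x‖ := by
  let c : EuclideanSpace ℝ (Fin d) → EuclideanSpace ℂ (Fin d) :=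
    fun y => WithLp.toLp 2 fun i => (y i : ℂ)
  have hc : ∀ y, ‖c y‖ = ‖y‖ := fun y => by simp [EuclideanSpace.norm_eq, c]
  have hB : Matrix.toEuclideanCLM (𝕜 := ℂ) (B.map (algebraMap ℝ ℂ)) (c x)
      = c (Matrix.toEuclideanCLM (𝕜 := ℝ) B x) := by
    ext i
    simp [c, Matrix.ofLp_toEuclideanCLM, Matrix.mulVec, dotProduct]
  rw [← hc, ← hB, ← hc x]
  exact ContinuousLinearMap.le_opNorm _ _

lemma IsHurwitz.exists_norm_exp_smul_le {A : Matrix (Fin d) (Fin d) ℝ} (hA : IsHurwitz A) :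
    ∃ lam : ℝ, 0 < lam ∧ ∃ C : ℝ, ∀ t : ℝ, 0 ≤ t → ∀ x : EuclideanSpace ℝ (Fin d),
      ‖NormedSpace.exp (t • Matrix.toEuclideanCLM (𝕜 := ℝ) A) x‖
        ≤ C * Real.exp (-lam * t) * ‖x‖ := by
  obtain ⟨lam, hlam, C, h⟩ := Matrix.exists_norm_exp_smul_le hA
  refine ⟨lam, hlam, C, fun t ht x => ?_⟩
  let _ := NormedAlgebra.restrictScalars ℚ ℝ (Matrix (Fin d) (Fin d) ℝ)
  have h1 : NormedSpace.exp (t • Matrix.toEuclideanCLM (𝕜 := ℝ) A)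
      = Matrix.toEuclideanCLM (𝕜 := ℝ) (NormedSpace.exp (t • A)) := by
    rw [← map_smul]
    refine (NormedSpace.map_exp (Matrix.toEuclideanCLM (n := Fin d) (𝕜 := ℝ)) ?_ _).symm
    exact LinearMap.continuous_of_finiteDimensional
      (Matrix.toEuclideanCLM (n := Fin d) (𝕜 := ℝ)).toAlgEquiv.toLinearMap
  have h2 : (NormedSpace.exp (t • A)).map (algebraMap ℝ ℂ)
      = NormedSpace.exp (t • A.map (algebraMap ℝ ℂ)) := by
    have h3 : Continuous ((algebraMap ℝ ℂ).mapMatrix : Matrix (Fin d) (Fin d) ℝ →+* _) :=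
      continuous_id.matrix_map Complex.continuous_ofReal
    have h4 := NormedSpace.map_exp (algebraMap ℝ ℂ).mapMatrix h3 (t • A)
    rw [RingHom.mapMatrix_apply] at h4
    rw [h4]
    congr 1
    ext i j
    simp
  rw [h1]
  refine (Matrix.norm_toEuclideanCLM_apply_le_norm_map _ x).trans ?_
  rw [h2]
  exact mul_le_mul_of_nonneg_right (h t ht) (norm_nonneg _)

end Hurwitz

/-! ### Norms adapted to a stable linear flow -/

section AdaptedNorm

variable {E : Type*} [NormedAddCommGroup E] [NormedSpace ℝ E]

/-- The function `x ↦ sup_{s ≥ 0} e^{lam s} ‖e^{sB} x‖`. If the semigroup `e^{sB}` decays at rate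
`lam`, this is a norm equivalent to the given one, and along the flow of `B` it decays at rate
`lam` from the very start, with no multiplicative constant. -/
noncomputable def adaptedNorm (B : E →L[ℝ] E) (lam : ℝ) (x : E) : ℝ :=
  ⨆ s : NNReal, Real.exp (lam * s) * ‖NormedSpace.exp ((s : ℝ) • B) x‖

variable {B : E →L[ℝ] E} {lam C : ℝ}
  (h : ∀ t : ℝ, 0 ≤ t → ∀ x, ‖NormedSpace.exp (t • B) x‖ ≤ C * Real.exp (-lam * t) * ‖x‖)

include h

lemma exp_mul_norm_exp_smul_le (x : E) (s : NNReal) :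
    Real.exp (lam * s) * ‖NormedSpace.exp ((s : ℝ) • B) x‖ ≤ C * ‖x‖ := by
  calc _ ≤ Real.exp (lam * s) * (C * Real.exp (-lam * s) * ‖x‖) := by
        gcongr
        exact h s s.2 x
    _ = C * ‖x‖ := by
        rw [neg_mul, Real.exp_neg]
        field_simp

lemma bddAbove_adaptedNorm (x : E) : BddAbove (Set.range fun s : NNReal =>
    Real.exp (lam * s) * ‖NormedSpace.exp ((s : ℝ) • B) x‖) :=
  ⟨C * ‖x‖, by rintro _ ⟨s, rfl⟩; exact exp_mul_norm_exp_smul_le h x s⟩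

lemma adaptedNorm_le (x : E) : adaptedNorm B lam x ≤ C * ‖x‖ :=
  ciSup_le (exp_mul_norm_exp_smul_le h x)

lemma norm_le_adaptedNorm (x : E) : ‖x‖ ≤ adaptedNorm B lam x := by
  have := le_ciSup (bddAbove_adaptedNorm h x) 0
  simpa [adaptedNorm, NormedSpace.exp_zero] using this

lemma adaptedNorm_exp_smul_le [CompleteSpace E] {t : ℝ} (ht : 0 ≤ t) (x : E) :
    adaptedNorm B lam (NormedSpace.exp (t • B) x) ≤ Real.exp (-lam * t) * adaptedNorm B lam x := by
  refine ciSup_le fun s => ?_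
  have h1 := le_ciSup (bddAbove_adaptedNorm h x) (s + t.toNNReal)
  let _ := NormedAlgebra.restrictScalars ℚ ℝ (E →L[ℝ] E)
  have h2 : NormedSpace.exp (((s : ℝ) + t) • B)
      = NormedSpace.exp ((s : ℝ) • B) * NormedSpace.exp (t • B) := by
    rw [add_smul, NormedSpace.exp_add_of_commute
      (((Commute.refl B).smul_left _).smul_right _)]
  simp only [NNReal.coe_add, Real.coe_toNNReal t ht, h2] at h1
  calc _ = Real.exp (-lam * t) * (Real.exp (lam * (s + t)) *
        ‖(NormedSpace.exp ((s : ℝ) • B) * NormedSpace.exp (t • B)) x‖) := by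
        rw [← mul_assoc, ← Real.exp_add]
        congr 2
        ring
    _ ≤ _ := mul_le_mul_of_nonneg_left h1 (Real.exp_pos _).le

lemma continuous_adaptedNorm : Continuous (adaptedNorm B lam) := by
  refine (LipschitzWith.of_le_add_mul' C fun x y => ciSup_le fun s => ?_).continuous
  have h1 := exp_mul_norm_exp_smul_le h (x - y) s
  have h2 := le_ciSup (bddAbove_adaptedNorm h y) s
  have h3 : ‖NormedSpace.exp ((s : ℝ) • B) x‖
      ≤ ‖NormedSpace.exp ((s : ℝ) • B) y‖ + ‖NormedSpace.exp ((s : ℝ) • B) (x - y)‖ := by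
    rw [map_sub]
    exact norm_le_norm_add_norm_sub' _ _
  rw [dist_eq_norm]
  calc _ ≤ Real.exp (lam * s) * (‖NormedSpace.exp ((s : ℝ) • B) y‖
        + ‖NormedSpace.exp ((s : ℝ) • B) (x - y)‖) := by gcongr
    _ ≤ _ := by rw [mul_add]; exact add_le_add h2 h1

end AdaptedNorm

/-! ### Growth of switched solutions -/

section Flow

variable {E : Type*} [NormedAddCommGroup E] [NormedSpace ℝ E] [CompleteSpace E]

/-- Solutions of `y' = B y` are given by the exponential of `B`. -/
lemma eq_exp_smul_of_hasDerivWithinAt {B : E →L[ℝ] E} {y : ℝ → E} {a b : ℝ}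
    (hy : ContinuousOn y (Set.Icc a b))
    (hd : ∀ t ∈ Set.Ico a b, HasDerivWithinAt y (B (y t)) (Set.Ici t) t) :
    ∀ t ∈ Set.Icc a b, y t = NormedSpace.exp ((t - a) • B) (y a) := by
  have hg : ∀ t, HasDerivAt (fun t : ℝ => NormedSpace.exp ((t - a) • B) (y a))
      (B (NormedSpace.exp ((t - a) • B) (y a))) t := by
    intro t
    have h1 := (hasDerivAt_exp_smul_const' (𝕂 := ℝ) B (t - a)).comp_sub_const t a
    simpa using h1.clm_apply (hasDerivAt_const t (y a))
  refine ODE_solution_unique_of_mem_Icc_right (v := fun _ z => B z) (s := fun _ => Set.univ)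
    (K := ‖B‖₊) (fun t _ => B.lipschitz.lipschitzOnWith) hy hd (fun _ _ => trivial) ?_
    (fun t _ => (hg t).hasDerivWithinAt) (fun _ _ => trivial) ?_
  · exact fun t _ => (hg t).continuousAt.continuousWithinAt
  · simp [NormedSpace.exp_zero]

end Flow

section Switched

variable {n d : ℕ} {A : Fin n → Matrix (Fin d) (Fin d) ℝ} {e : ℝ → Fin n}
  {x : ℝ → EuclideanSpace ℝ (Fin d)}

lemma IsSwitchedSolution.continuousOn (hx : IsSwitchedSolution A e x) :
    ContinuousOn x (Set.Ici 0) := by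
  have hT : ∀ T : ℝ, 0 < T → ContinuousOn x (Set.Icc 0 T) := by
    intro T hT
    have h1 : ContinuousOn (fun t => ∫ s in (0 : ℝ)..t, Matrix.toEuclideanLin (A (e s)) (x s))
        (Set.uIcc 0 T) :=
      intervalIntegral.continuousOn_primitive_interval'
        (hx T hT.le).1 Set.left_mem_uIcc
    rw [Set.uIcc_of_le hT.le] at h1
    exact (continuousOn_const.add h1).congr fun t ht => (hx t ht.1).2
  intro t ht
  have ht' : (0 : ℝ) ≤ t := ht
  have h2 := hT (t + 1) (by linarith) t ⟨ht', by linarith⟩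
  refine h2.mono_of_mem_nhdsWithin ?_
  filter_upwards [self_mem_nhdsWithin, nhdsWithin_le_nhds (Iio_mem_nhds (lt_add_one t))]
    with s hs hs' using ⟨hs, le_of_lt hs'⟩

/-- While the switching path rests in one state, a switched solution follows the linear flow of
that state. -/
lemma IsSwitchedSolution.eq_exp_smul (hx : IsSwitchedSolution A e x) {s t : ℝ} (hs : 0 ≤ s)
    (hst : s ≤ t) {i : Fin n} (he : ∀ u ∈ Set.Ico s t, e u = i) :
    x t = NormedSpace.exp ((t - s) • Matrix.toEuclideanCLM (𝕜 := ℝ) (A i)) (x s) := by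
  set B := Matrix.toEuclideanCLM (𝕜 := ℝ) (A i) with hB
  -- Freezing `x` at negative times makes it continuous on the whole line.
  have hc : Continuous fun u => x (max u 0) :=
    hx.continuousOn.comp_continuous (by fun_prop) fun u => le_max_right u 0
  set y : ℝ → EuclideanSpace ℝ (Fin d) := fun u => x s + ∫ r in s..u, B (x (max r 0)) with hy
  have hyd : ∀ u, HasDerivAt y (B (x (max u 0))) u := by
    intro u
    have hBc : Continuous fun r => B (x (max r 0)) := B.continuous.comp hc
    exact (intervalIntegral.integral_hasDerivAt_right (hBc.intervalIntegrable _ _)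
      hBc.aestronglyMeasurable.stronglyMeasurableAtFilter hBc.continuousAt).const_add (x s)
  have hyx : ∀ u ∈ Set.Icc s t, y u = x u := by
    intro u hu
    have h0u : 0 ≤ u := hs.trans hu.1
    have h1 := (hx u h0u).2
    have h2 := (hx s hs).2
    have h3 := intervalIntegral.integral_interval_sub_left (hx u h0u).1 (hx s hs).1
    have h4 : ∫ r in s..u, Matrix.toEuclideanLin (A (e r)) (x r)
        = ∫ r in s..u, B (x (max r 0)) := by
      refine intervalIntegral.integral_congr_ae ?_
      filter_upwards [(compl_mem_ae_iff (μ := volume)).2 (Real.volume_singleton (a := t))]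
        with r hr hr'
      rw [Set.uIoc_of_le hu.1] at hr'
      have hrt : r < t := lt_of_le_of_ne (hr'.2.trans hu.2) hr
      rw [he r ⟨hr'.1.le, hrt⟩, max_eq_left (hs.trans hr'.1.le), hB]
      rfl
    rw [hy]
    simp only
    rw [← h4, ← h3, h1]
    nth_rewrite 1 [h2]
    abel
  have key := eq_exp_smul_of_hasDerivWithinAt (B := B) (y := y) (a := s) (b := t)
    (fun u _ => (hyd u).continuousAt.continuousWithinAt) (fun u hu => by
      have := (hyd u).hasDerivWithinAt (s := Set.Ici u)
      rwa [max_eq_left (hs.trans hu.1), ← hyx u ⟨hu.1, hu.2.le⟩] at this) t ⟨hst, le_rfl⟩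
  rwa [hyx t ⟨hst, le_rfl⟩, hyx s ⟨le_rfl, hst⟩] at key

/-- Let `V i` be a norm that decays at rate `lam` under the flow of `A i`, where any two of these
norms differ by a factor of at most `K`, and let `W` be a nondecreasing function that gains a
factor `K` between any two times at which the path is in different states. Then the solution,
measured at time `t` in the norm of the state at time `t`, is at most `W t * exp (-lam * t)` times
its initial value. The proof is an induction along the interval. To reach a time `t` from the
left, the states just before `t` need not be known: the bounds at times `s < t`, rewritten in the
norm of the state at time `t`, already carry the factor `W t`. -/
lemma IsSwitchedSolution.le_of_growth (hx : IsSwitchedSolution A e x)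
    (he : ∀ t, 0 ≤ t → ∀ᶠ s in 𝓝[>] t, e s = e t)
    {V : Fin n → EuclideanSpace ℝ (Fin d) → ℝ} {lam K T : ℝ} {W : ℝ → ℝ} (hK : 0 ≤ K)
    (hVc : ∀ i, Continuous (V i)) (hV0 : ∀ i y, 0 ≤ V i y) (hVK : ∀ i j y, V i y ≤ K * V j y)
    (hVexp : ∀ i t, 0 ≤ t → ∀ y, V i (NormedSpace.exp
      (t • Matrix.toEuclideanCLM (𝕜 := ℝ) (A i)) y) ≤ Real.exp (-lam * t) * V i y)
    (hW0 : 1 ≤ W 0) (hWmono : ∀ s t, 0 ≤ s → s ≤ t → t ≤ T → W s ≤ W t)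
    (hWK : ∀ s t, 0 ≤ s → s ≤ t → t ≤ T → e s ≠ e t → K * W s ≤ W t) :
    ∀ t ∈ Set.Icc 0 T, V (e t) (x t) ≤ W t * Real.exp (-lam * t) * V (e 0) (x 0) := by
  set v0 := V (e 0) (x 0) with hv0
  have hv0' : 0 ≤ v0 := hV0 _ _
  let P : ℝ → Prop := fun t => V (e t) (x t) ≤ W t * Real.exp (-lam * t) * v0
  let S : Set ℝ := {t | ∀ u, 0 ≤ u → u ≤ t → P u}
  have hleft : ∀ t, 0 < t → t ≤ T → (∀ u, 0 ≤ u → u < t → P u) → P t := by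
    intro t ht htT hu
    have h1 : Tendsto (fun s => V (e t) (x s)) (𝓝[<] t) (𝓝 (V (e t) (x t))) := by
      have hxt : ContinuousAt x t := hx.continuousOn.continuousAt (Ici_mem_nhds ht)
      exact ((hVc (e t)).continuousAt.comp hxt).tendsto.mono_left nhdsWithin_le_nhds
    have h2 : Tendsto (fun s => W t * Real.exp (-lam * s) * v0) (𝓝[<] t)
        (𝓝 (W t * Real.exp (-lam * t) * v0)) := by
      have : Continuous fun s => W t * Real.exp (-lam * s) * v0 := by fun_prop
      exact this.continuousAt.tendsto.mono_left nhdsWithin_le_nhds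
    refine le_of_tendsto_of_tendsto h1 h2 ?_
    filter_upwards [self_mem_nhdsWithin, nhdsWithin_le_nhds (Ioi_mem_nhds ht)] with s hs hs0
    have hs' : s < t := hs
    have hs0' : 0 < s := hs0
    have hP := hu s hs0'.le hs'
    have hE : 0 ≤ Real.exp (-lam * s) * v0 := mul_nonneg (Real.exp_pos _).le hv0'
    by_cases hst : e s = e t
    · rw [← hst]
      refine hP.trans ?_
      rw [mul_assoc, mul_assoc]
      exact mul_le_mul_of_nonneg_right (hWmono s t hs0'.le hs'.le htT) hE
    · refine (hVK (e t) (e s) (x s)).trans ((mul_le_mul_of_nonneg_left hP hK).trans ?_)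
      rw [mul_assoc, mul_assoc, ← mul_assoc]
      exact mul_le_mul_of_nonneg_right (hWK s t hs0'.le hs'.le htT hst) hE
  have hclosed : IsClosed (S ∩ Set.Icc 0 T) := by
    refine isClosed_of_closure_subset fun t ht => ?_
    have htI : t ∈ Set.Icc 0 T :=
      closure_minimal Set.inter_subset_right isClosed_Icc ht
    have hlt : ∀ u, 0 ≤ u → u < t → P u := by
      intro u hu0 hut
      obtain ⟨s, hsu, hs⟩ := mem_closure_iff.1 ht (Set.Ioi u) isOpen_Ioi hut
      exact hs.1 u hu0 (le_of_lt hsu)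
    refine ⟨fun u hu0 hut => ?_, htI⟩
    rcases hut.lt_or_eq with h | rfl
    · exact hlt u hu0 h
    · rcases hu0.lt_or_eq with h | rfl
      · exact hleft u h htI.2 hlt
      · simpa [P] using le_mul_of_one_le_left hv0' hW0
  have hzero : (0 : ℝ) ∈ S := by
    intro u hu0 hu1
    obtain rfl : u = 0 := le_antisymm hu1 hu0
    simpa [P] using le_mul_of_one_le_left hv0' hW0
  have hstep : ∀ t ∈ S ∩ Set.Ico 0 T, ∀ y ∈ Set.Ioi t, (S ∩ Set.Ioc t y).Nonempty := by
    rintro t ⟨htS, ht0, htT⟩ y hy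
    have h0 : ∀ᶠ s in 𝓝[>] t, e s = e t := he t ht0
    obtain ⟨u, hu, hcon⟩ := mem_nhdsGT_iff_exists_Ioo_subset.1 h0
    have htu : t < u := hu
    have hty : t < y := hy
    obtain ⟨z, htz, hz⟩ := exists_between (lt_min (lt_min htu hty) htT)
    simp only [lt_min_iff] at hz
    refine ⟨z, fun s hs0 hsz => ?_, htz, hz.1.2.le⟩
    rcases le_or_gt s t with hst | hst
    · exact htS s hs0 hst
    · have hes : e s = e t := hcon ⟨hst, lt_of_le_of_lt hsz hz.1.1⟩
      have hsol := hx.eq_exp_smul ht0 hst.le (i := e t) fun r hr => by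
        rcases hr.1.lt_or_eq with h | h
        · exact hcon ⟨h, hr.2.trans (lt_of_le_of_lt hsz hz.1.1)⟩
        · rw [← h]
      have h1 := hVexp (e t) (s - t) (by linarith) (x t)
      rw [← hsol] at h1
      have hPt : P t := htS t ht0 le_rfl
      change V (e s) (x s) ≤ _
      rw [hes]
      calc V (e t) (x s) ≤ Real.exp (-lam * (s - t)) * V (e t) (x t) := h1
        _ ≤ Real.exp (-lam * (s - t)) * (W t * Real.exp (-lam * t) * v0) := by
            exact mul_le_mul_of_nonneg_left hPt (Real.exp_pos _).le
        _ = W t * (Real.exp (-lam * (s - t)) * Real.exp (-lam * t) * v0) := by ring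
        _ = W t * (Real.exp (-lam * s) * v0) := by
            rw [← Real.exp_add]
            congr 4
            ring
        _ ≤ W s * (Real.exp (-lam * s) * v0) := by
            refine mul_le_mul_of_nonneg_right (hWmono t s ht0 hst.le ?_) ?_
            · exact hsz.trans hz.2.le
            · exact mul_nonneg (Real.exp_pos _).le hv0'
        _ = _ := by ring
  intro t ht
  exact hclosed.Icc_subset_of_forall_exists_gt hzero hstep ht t ht.1 le_rfl

end Switched

/-! ### Counting changes of state along grids -/

section Changes

variable {n : ℕ}

/-- The number of changes `a l ≠ a (l + 1)` among the first `m` steps of the sequence `a`. -/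
def numChanges (a : ℕ → Fin n) (m : ℕ) : ℕ :=
  ∑ l ∈ Finset.range m, if a (l + 1) ≠ a l then 1 else 0

lemma numChanges_succ (a : ℕ → Fin n) (m : ℕ) :
    numChanges a (m + 1) = numChanges a m + if a (m + 1) ≠ a m then 1 else 0 :=
  Finset.sum_range_succ _ _

lemma numChanges_congr {a b : ℕ → Fin n} {m : ℕ} (h : ∀ l ≤ m, a l = b l) :
    numChanges a m = numChanges b m := by
  refine Finset.sum_congr rfl fun l hl => ?_
  rw [Finset.mem_range] at hl
  rw [h l hl.le, h (l + 1) hl]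

lemma numChanges_mono (a : ℕ → Fin n) : Monotone (numChanges a) :=
  monotone_nat_of_le_succ fun m => by rw [numChanges_succ]; exact Nat.le_add_right _ _

lemma numChanges_add_one_le (a : ℕ → Fin n) {i j : ℕ} (hij : i ≤ j) (h : a i ≠ a j) :
    numChanges a i + 1 ≤ numChanges a j := by
  induction j, hij using Nat.le_induction with
  | base => exact absurd rfl h
  | succ j hij ih =>
    rw [numChanges_succ]
    by_cases hj : a (j + 1) = a j
    · exact (ih (hj ▸ h)).trans (Nat.le_add_right _ _)
    · rw [if_pos hj]
      exact Nat.add_le_add_right (numChanges_mono a hij) 1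

/-- The factor `(1 + c) ^ N` for the number `N` of changes of state of the path `e` on `[0, t]`,
where `N` is read off along the grids of mesh `1 / (k + 1)` in the limit `k → ∞`. For a
right-continuous path the lower limit never misses a change (see
`one_add_mul_gridGrowth_le`). -/
noncomputable def gridGrowth (c : ENNReal) (e : ℝ → Fin n) (t : ℝ) : ENNReal :=
  liminf (fun k : ℕ => (1 + c) ^ numChanges (fun l : ℕ => e (l / (k + 1))) ⌈t * (k + 1)⌉₊) atTop

lemma gridGrowth_zero (c : ENNReal) (e : ℝ → Fin n) : gridGrowth c e 0 = 1 := by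
  simp [gridGrowth, numChanges]

lemma gridGrowth_mono (c : ENNReal) (e : ℝ → Fin n) : Monotone (gridGrowth c e) := by
  intro s t hst
  refine liminf_le_liminf (Eventually.of_forall fun k => ?_)
  refine pow_le_pow_right' (by simp) (numChanges_mono _ (Nat.ceil_mono ?_))
  gcongr

/-- A right-continuous path agrees at time `t` with its value at the first point of a fine grid
that is not before `t`. -/
lemma eventually_grid_eq {e : ℝ → Fin n} {t : ℝ} (ht : 0 ≤ t)
    (he : ∀ᶠ s in 𝓝[>] t, e s = e t) :
    ∀ᶠ k : ℕ in atTop, e ((⌈t * (k + 1)⌉₊ : ℝ) / (k + 1)) = e t := by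
  obtain ⟨u, hu, hcon⟩ := mem_nhdsGT_iff_exists_Ioo_subset.1 he
  have htu : t < u := hu
  have hlim : ∀ᶠ k : ℕ in atTop, 1 / ((k : ℝ) + 1) < u - t :=
    tendsto_one_div_add_atTop_nhds_zero_nat.eventually_lt_const (by linarith)
  filter_upwards [hlim] with k hk
  have hk0 : (0 : ℝ) < k + 1 := by positivity
  have h1 : t ≤ (⌈t * (k + 1)⌉₊ : ℝ) / (k + 1) := by
    rw [le_div_iff₀ hk0]
    exact Nat.le_ceil _
  have h2 : (⌈t * (k + 1)⌉₊ : ℝ) / (k + 1) < u := by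
    have h3 := Nat.ceil_lt_add_one (a := t * ((k : ℝ) + 1)) (by positivity)
    have h4 : (⌈t * (k + 1)⌉₊ : ℝ) / (k + 1) < t + 1 / (k + 1) := by
      rw [div_lt_iff₀ hk0, add_mul, one_div_mul_cancel hk0.ne']
      exact h3
    linarith
  rcases h1.lt_or_eq with h | h
  · exact hcon ⟨h, h2⟩
  · rw [← h]

lemma one_add_mul_gridGrowth_le {c : ENNReal} (hc : c ≠ ⊤) {e : ℝ → Fin n} {s t : ℝ} (hs : 0 ≤ s)
    (hst : s ≤ t) (hes : ∀ᶠ u in 𝓝[>] s, e u = e s) (het : ∀ᶠ u in 𝓝[>] t, e u = e t)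
    (hne : e s ≠ e t) : (1 + c) * gridGrowth c e s ≤ gridGrowth c e t := by
  rw [gridGrowth, ← ENNReal.liminf_const_mul_of_ne_top (by simp [hc])]
  refine liminf_le_liminf ?_
  filter_upwards [eventually_grid_eq hs hes, eventually_grid_eq (hs.trans hst) het] with k h1 h2
  rw [← pow_succ']
  refine pow_le_pow_right' (by simp) (numChanges_add_one_le _ (Nat.ceil_mono (by gcongr)) ?_)
  rwa [h1, h2]

end Changes

/-! ### Exponential moments of the number of changes of a Markov process -/

section Moments

variable {n : ℕ} {Ω : Type*} [MeasurableSpace Ω] {μ : Measure Ω}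
  {G : Matrix (Fin n) (Fin n) ℝ} {I : ℝ → Ω → Fin n}

/-- Given the states of a Markov process at the times `t 0, …, t m`, its state changes in the next
time step with conditional probability at most `p`. The states are recorded by `q`. -/
lemma IsMarkovProcess.measure_change_le [IsProbabilityMeasure μ]
    (hI : IsMarkovProcess μ G I) {t : ℕ → ℝ} (ht0 : 0 ≤ t 0)
    (ht : Monotone t) {p : ℝ} (m : ℕ)
    (hp : ∀ i, 1 - NormedSpace.exp ((t (m + 1) - t m) • G) i i ≤ p) (q : ℕ → Fin n)
    (hq : q (m + 1) = q m) :
    μ ({ω | ∀ k ≤ m, I (t k) ω = q k} ∩ {ω | I (t (m + 1)) ω ≠ I (t m) ω}) ≤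
      ENNReal.ofReal p * μ {ω | ∀ k ≤ m, I (t k) ω = q k} := by
  have htn : ∀ k, 0 ≤ t k := fun k => ht0.trans (ht (Nat.zero_le k))
  have hmeas : ∀ j, MeasurableSet {ω | ∀ k ≤ j, I (t k) ω = q k} := by
    intro j
    have : {ω | ∀ k ≤ j, I (t k) ω = q k} = ⋂ k, ⋂ (_ : k ≤ j), I (t k) ⁻¹' {q k} := by
      ext ω
      simp
    rw [this]
    exact MeasurableSet.iInter fun k => MeasurableSet.iInter fun _ =>
      hI.measurable _ (htn k) (measurableSet_singleton _)
  set S := {ω | ∀ k ≤ m, I (t k) ω = q k} with hS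
  set S' := {ω | ∀ k ≤ m + 1, I (t k) ω = q k} with hS'
  have hsub : S' ⊆ S := fun ω hω k hk => hω k (hk.trans (Nat.le_succ m))
  have heq : S ∩ {ω | I (t (m + 1)) ω ≠ I (t m) ω} = S \ S' := by
    ext ω
    refine and_congr_right fun hω => not_congr ⟨fun h k hk => ?_, fun h => ?_⟩
    · rcases Nat.le_succ_iff.1 hk with hk | rfl
      · exact hω k hk
      · rw [h, hω m le_rfl, hq]
    · rw [h (m + 1) le_rfl, hω m le_rfl, hq]
  have h1 : μ.real S' = μ.real S * NormedSpace.exp ((t (m + 1) - t m) • G) (q m) (q m) := by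
    rw [hS, hS', hI.finite_dim _ t q ht0 ht, hI.finite_dim _ t q ht0 ht, Finset.prod_range_succ,
      hq, mul_assoc]
  have h2 : μ.real (S \ S') ≤ p * μ.real S := by
    rw [measureReal_sdiff hsub (hmeas _), h1]
    nlinarith [hp (q m), measureReal_nonneg (μ := μ) (s := S)]
  rw [heq, ← ENNReal.ofReal_toReal (measure_ne_top μ (S \ S')),
    ← ENNReal.ofReal_toReal (measure_ne_top μ S)]
  refine (ENNReal.ofReal_le_ofReal h2).trans ?_
  rw [ENNReal.ofReal_mul' measureReal_nonneg]
  rfl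

/-- Along a time sequence in which each step has a change of state with conditional probability at
most `p`, the number of changes has the exponential moments of a binomial variable. -/
lemma IsMarkovProcess.lintegral_pow_numChanges_le [IsProbabilityMeasure μ]
    (hI : IsMarkovProcess μ G I) {t : ℕ → ℝ}
    (ht0 : 0 ≤ t 0) (ht : Monotone t) {p : ℝ}
    (hp : ∀ m i, 1 - NormedSpace.exp ((t (m + 1) - t m) • G) i i ≤ p) (c : ENNReal) (m : ℕ) :
    ∫⁻ ω, (1 + c) ^ numChanges (fun l => I (t l) ω) m ∂μ ≤ (1 + c * ENNReal.ofReal p) ^ m := by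
  have htn : ∀ k, 0 ≤ t k := fun k => ht0.trans (ht (Nat.zero_le k))
  induction m with
  | zero => simp [numChanges]
  | succ m ih =>
    -- A tuple of `m + 1` states, continued by its last entry.
    let ext : (Fin (m + 1) → Fin n) → ℕ → Fin n := fun q k => q ⟨min k m, by omega⟩
    let Φ : Ω → Fin (m + 1) → Fin n := fun ω l => I (t l) ω
    let g : (Fin (m + 1) → Fin n) → ENNReal := fun q => (1 + c) ^ numChanges (ext q) m
    set D := {ω | I (t (m + 1)) ω ≠ I (t m) ω} with hD
    have hDm : MeasurableSet D :=
      (measurableSet_eq_fun (hI.measurable _ (htn _)) (hI.measurable _ (htn _))).compl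
    have hΦ : Measurable Φ := measurable_pi_lambda _ fun l => hI.measurable _ (htn l)
    have hg : Measurable g := measurable_of_countable g
    have hgΦ : ∀ ω, (1 + c) ^ numChanges (fun l => I (t l) ω) m = g (Φ ω) := by
      intro ω
      simp only [g]
      congr 1
      refine numChanges_congr fun l hl => ?_
      simp [ext, Φ, min_eq_left hl]
    have hpre : ∀ q, Φ ⁻¹' {q} = {ω | ∀ k ≤ m, I (t k) ω = ext q k} := by
      intro q
      ext ω
      simp only [Set.mem_preimage, Set.mem_singleton_iff, Set.mem_ofPred_eq, funext_iff]
      constructor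
      · intro h k hk
        simpa [ext, Φ, min_eq_left hk] using h ⟨k, by omega⟩
      · intro h l
        have hl : (l : ℕ) ≤ m := by omega
        simpa [ext, Φ, min_eq_left hl] using h l hl
    have hstep : ∫⁻ ω in D, g (Φ ω) ∂μ ≤ ENNReal.ofReal p * ∫⁻ ω, g (Φ ω) ∂μ := by
      rw [← lintegral_map hg hΦ, ← lintegral_map hg hΦ, lintegral_fintype, lintegral_fintype,
        Finset.mul_sum]
      refine Finset.sum_le_sum fun q _ => ?_
      rw [Measure.map_apply hΦ (measurableSet_singleton _),
        Measure.map_apply hΦ (measurableSet_singleton _),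
        Measure.restrict_apply (hΦ (measurableSet_singleton _)), hpre, mul_left_comm]
      refine mul_le_mul_right ?_ _
      exact hI.measure_change_le ht0 ht m (hp m) (ext q) (by simp [ext])
    have hsplit : ∀ ω, (1 + c) ^ numChanges (fun l => I (t l) ω) (m + 1)
        = g (Φ ω) + c * D.indicator (fun ω => g (Φ ω)) ω := by
      intro ω
      rw [numChanges_succ, pow_add, hgΦ]
      by_cases h : I (t (m + 1)) ω ≠ I (t m) ω
      · rw [if_pos h, Set.indicator_of_mem (s := D) h, pow_one]
        ring
      · rw [if_neg h, Set.indicator_of_notMem (s := D) h, pow_zero, mul_one, mul_zero, add_zero]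
    have hgm : Measurable fun ω => g (Φ ω) := hg.comp hΦ
    simp_rw [hgΦ] at ih
    simp_rw [hsplit]
    rw [lintegral_add_left hgm, lintegral_const_mul _ (hgm.indicator hDm),
      lintegral_indicator hDm]
    calc _ ≤ ∫⁻ ω, g (Φ ω) ∂μ + c * (ENNReal.ofReal p * ∫⁻ ω, g (Φ ω) ∂μ) := by gcongr
      _ = (1 + c * ENNReal.ofReal p) * ∫⁻ ω, g (Φ ω) ∂μ := by ring
      _ ≤ (1 + c * ENNReal.ofReal p) * (1 + c * ENNReal.ofReal p) ^ m := by gcongr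
      _ = _ := (pow_succ' _ _).symm

lemma IsMarkovProcess.measurable_pow_numChanges (hI : IsMarkovProcess μ G I) {t : ℕ → ℝ}
    (ht : ∀ l, 0 ≤ t l) (c : ENNReal) (m : ℕ) :
    Measurable fun ω => (1 + c) ^ numChanges (fun l => I (t l) ω) m := by
  have h : Measurable fun ω => numChanges (fun l => I (t l) ω) m :=
    Finset.measurable_sum _ fun l _ => Measurable.ite
      (measurableSet_eq_fun (hI.measurable _ (ht _)) (hI.measurable _ (ht _))).compl
      measurable_const measurable_const
  exact (measurable_of_countable fun N : ℕ => (1 + c) ^ N).comp h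

lemma IsMarkovProcess.measurable_gridGrowth (hI : IsMarkovProcess μ G I) (c : ENNReal) (t : ℝ) :
    Measurable fun ω => gridGrowth c (fun s => I s ω) t :=
  Measurable.liminf fun k => hI.measurable_pow_numChanges
    (t := fun l : ℕ => (l : ℝ) / (k + 1))
    (fun l => div_nonneg (Nat.cast_nonneg l) (Nat.cast_add_one_pos k).le) _ _

/-- The probability of leaving a state within a short time `t` is at most linear in `t`. -/
lemma exists_one_sub_exp_smul_le (Q : Matrix (Fin n) (Fin n) ℝ) :
    ∃ b : ℝ, 0 < b ∧ ∀ᶠ t in 𝓝[>] (0 : ℝ), ∀ i, 1 - NormedSpace.exp (t • Q) i i ≤ b * t := by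
  obtain ⟨b, hb0, hb⟩ : ∃ b : ℝ, 0 < b ∧ ∀ i, -Q i i < b :=
    ((eventually_gt_atTop (0 : ℝ)).and
      (eventually_all.2 fun i => eventually_gt_atTop (-Q i i))).exists
  refine ⟨b, hb0, eventually_all.2 fun i => ?_⟩
  have h1 : HasDerivAt (fun t : ℝ => NormedSpace.exp (t • Q) i i) (Q i i) 0 := by
    open scoped Matrix.Norms.L2Operator in
    have h2 := hasDerivAt_exp_smul_const (𝕂 := ℝ) Q 0
    rw [zero_smul, NormedSpace.exp_zero, one_mul] at h2
    exact ((Matrix.entryLinearMap ℝ ℝ i i).toContinuousLinearMap.hasFDerivAt.comp_hasDerivAt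
      (0 : ℝ) h2)
  have h3 := (hasDerivAt_iff_tendsto_slope.1 h1).mono_left
    (nhdsWithin_mono 0 fun x (hx : 0 < x) => hx.ne')
  have h4 : ∀ᶠ t in 𝓝[>] (0 : ℝ), -b < slope (fun t : ℝ => NormedSpace.exp (t • Q) i i) 0 t :=
    h3.eventually_const_lt (by linarith [hb i])
  filter_upwards [h4, self_mem_nhdsWithin] with t ht ht0
  have ht0' : 0 < t := ht0
  rw [slope_def_field, zero_smul, NormedSpace.exp_zero, Matrix.one_apply_eq, sub_zero,
    lt_div_iff₀ ht0'] at ht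
  linarith

/-- The expected growth factor up to an integer time is at most exponential in that time, with the
rate of departure as a factor of the exponent. -/
lemma IsMarkovProcess.lintegral_gridGrowth_le [IsProbabilityMeasure μ]
    (hI : IsMarkovProcess μ G I) {b c : ℝ} (hb : 0 ≤ b)
    (hc : 0 ≤ c)
    (hG : ∀ᶠ t in 𝓝[>] (0 : ℝ), ∀ i, 1 - NormedSpace.exp (t • G) i i ≤ b * t) (m : ℕ) :
    ∫⁻ ω, gridGrowth (ENNReal.ofReal c) (fun t => I t ω) m ∂μ
      ≤ ENNReal.ofReal (Real.exp (c * b * m)) := by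
  have hlim : Tendsto (fun k : ℕ => 1 / ((k : ℝ) + 1)) atTop (𝓝[>] 0) :=
    tendsto_nhdsWithin_iff.2 ⟨tendsto_one_div_add_atTop_nhds_zero_nat,
      Eventually.of_forall fun k => Set.mem_Ioi.2 (by positivity)⟩
  refine (lintegral_liminf_le fun k : ℕ => hI.measurable_pow_numChanges
    (t := fun l : ℕ => (l : ℝ) / (k + 1)) (fun l => div_nonneg (Nat.cast_nonneg l) (Nat.cast_add_one_pos k).le) _ _).trans ?_
  refine (liminf_le_liminf (v := fun _ => ENNReal.ofReal (Real.exp (c * b * m))) ?_).trans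
    (by simp)
  filter_upwards [hlim.eventually hG] with k hk
  have hk0 : (0 : ℝ) < k + 1 := by positivity
  have hceil : ⌈(m : ℝ) * (k + 1)⌉₊ = m * (k + 1) := by
    rw [← Nat.cast_add_one, ← Nat.cast_mul, Nat.ceil_natCast]
  rw [hceil]
  refine (hI.lintegral_pow_numChanges_le (t := fun l : ℕ => (l : ℝ) / (k + 1)) (by simp)
    (fun i j hij => div_le_div_of_nonneg_right (Nat.cast_le.2 hij) hk0.le) (p := b * (1 / (k + 1))) (fun l i => ?_) _ _).trans ?_
  · have : ((l + 1 : ℕ) : ℝ) / (k + 1) - (l : ℝ) / (k + 1) = 1 / (k + 1) := by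
      push_cast
      ring
    rw [this]
    exact hk i
  · have hp : 0 ≤ c * (b * (1 / ((k : ℝ) + 1))) := by positivity
    rw [← ENNReal.ofReal_mul hc, ← ENNReal.ofReal_one, ← ENNReal.ofReal_add zero_le_one hp,
      ← ENNReal.ofReal_pow (by positivity)]
    refine ENNReal.ofReal_le_ofReal ?_
    calc (1 + c * (b * (1 / ((k : ℝ) + 1)))) ^ (m * (k + 1))
        ≤ Real.exp (c * (b * (1 / ((k : ℝ) + 1)))) ^ (m * (k + 1)) := by
          gcongr
          linarith [Real.add_one_le_exp (c * (b * (1 / ((k : ℝ) + 1))))]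
      _ = Real.exp (c * b * m) := by
          rw [← Real.exp_nat_mul]
          congr 1
          push_cast
          field_simp

end Moments

/-! ### Stability under slow switching -/

/-- Finitely many Hurwitz matrices have adapted norms with a common decay rate and a common
comparison constant. -/
lemma exists_common_adaptedNorm {n d : ℕ} {A : Fin n → Matrix (Fin d) (Fin d) ℝ}
    (hA : ∀ i, IsHurwitz (A i)) :
    ∃ lam : ℝ, 0 < lam ∧ ∃ K : ℝ, 1 < K ∧ ∃ V : Fin n → EuclideanSpace ℝ (Fin d) → ℝ,
      (∀ i, Continuous (V i)) ∧ (∀ i y, ‖y‖ ≤ V i y) ∧ (∀ i j y, V i y ≤ K * V j y) ∧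
      ∀ i t, 0 ≤ t → ∀ y, V i (NormedSpace.exp
        (t • Matrix.toEuclideanCLM (𝕜 := ℝ) (A i)) y) ≤ Real.exp (-lam * t) * V i y := by
  choose l hl C hC using fun i => (hA i).exists_norm_exp_smul_le
  obtain ⟨lam, hlam0, hlam⟩ : ∃ lam : ℝ, 0 < lam ∧ ∀ i, lam < l i :=
    ((eventually_mem_nhdsWithin (a := (0 : ℝ)) (s := Set.Ioi 0)).and (eventually_all.2 fun i =>
      eventually_nhdsWithin_of_eventually_nhds (eventually_lt_nhds (hl i)))).exists
  obtain ⟨K, hK1, hK⟩ : ∃ K : ℝ, 1 < K ∧ ∀ i, C i < K :=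
    ((eventually_gt_atTop (1 : ℝ)).and
      (eventually_all.2 fun i => eventually_gt_atTop (C i))).exists
  have h : ∀ i, ∀ t : ℝ, 0 ≤ t → ∀ y,
      ‖NormedSpace.exp (t • Matrix.toEuclideanCLM (𝕜 := ℝ) (A i)) y‖
        ≤ K * Real.exp (-lam * t) * ‖y‖ := by
    intro i t ht y
    refine (hC i t ht y).trans ?_
    have h1 : -l i * t ≤ -lam * t := by nlinarith [hlam i]
    have := (hK i).le
    gcongr
  refine ⟨lam, hlam0, K, hK1, fun i => adaptedNorm (Matrix.toEuclideanCLM (𝕜 := ℝ) (A i)) lam,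
    fun i => continuous_adaptedNorm (h i), fun i => norm_le_adaptedNorm (h i), fun i j y => ?_,
    fun i t ht => adaptedNorm_exp_smul_le (h i) ht⟩
  exact (adaptedNorm_le (h i) y).trans
    (mul_le_mul_of_nonneg_left (norm_le_adaptedNorm (h j) y) (by linarith))

/-- If the expectation of `W m` grows in `m` at most like `exp (α * m)`, then almost surely `W m`
grows at most like `exp (β * m)`, for every `β > α`. -/
lemma ae_exists_le_mul_exp {Ω : Type*} [MeasurableSpace Ω] {μ : Measure Ω} {W : ℕ → Ω → ENNReal}
    (hW : ∀ m, AEMeasurable (W m) μ) {α β : ℝ} (hαβ : α < β)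
    (h : ∀ m : ℕ, ∫⁻ ω, W m ω ∂μ ≤ ENNReal.ofReal (Real.exp (α * m))) :
    ∀ᵐ ω ∂μ, ∃ M : ENNReal, M ≠ ⊤ ∧ ∀ m : ℕ, W m ω ≤ M * ENNReal.ofReal (Real.exp (β * m)) := by
  set w : ℕ → Ω → ENNReal := fun m ω => ENNReal.ofReal (Real.exp (-β * m)) * W m ω with hw
  have hwm : ∀ m, AEMeasurable (w m) μ := fun m => (hW m).const_mul _
  have hsum : ∫⁻ ω, ∑' m, w m ω ∂μ ≠ ⊤ := by
    rw [lintegral_tsum hwm]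
    have hle : ∀ m : ℕ, ∫⁻ ω, w m ω ∂μ ≤ ENNReal.ofReal (Real.exp (m * (α - β))) := by
      intro m
      rw [hw]
      simp only
      rw [lintegral_const_mul' _ _ ENNReal.ofReal_ne_top]
      refine (mul_le_mul_right (h m) _).trans (le_of_eq ?_)
      rw [← ENNReal.ofReal_mul (Real.exp_pos _).le, ← Real.exp_add]
      congr 2
      ring
    refine ne_top_of_le_ne_top ?_ (ENNReal.tsum_le_tsum hle)
    exact (Real.summable_exp_nat_mul_iff.2 (by linarith)).tsum_ofReal_ne_top
  filter_upwards [ae_lt_top' (AEMeasurable.tsum hwm) hsum] with ω hω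
  refine ⟨∑' m, w m ω, hω.ne, fun m => ?_⟩
  calc W m ω = w m ω * ENNReal.ofReal (Real.exp (β * m)) := by
        rw [hw]
        simp only
        rw [mul_right_comm, ← ENNReal.ofReal_mul (Real.exp_pos _).le, ← Real.exp_add]
        simp
    _ ≤ _ := by
        gcongr
        exact ENNReal.le_tsum m

/-- A switched solution tends to `0` if the growth factor of its switching path is of smaller
exponential order than the decay of the adapted norms. -/
lemma IsSwitchedSolution.tendsto_norm_zero {n d : ℕ} {A : Fin n → Matrix (Fin d) (Fin d) ℝ}
    {e : ℝ → Fin n} {x : ℝ → EuclideanSpace ℝ (Fin d)} (hx : IsSwitchedSolution A e x)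
    (he : ∀ t, 0 ≤ t → ∀ᶠ s in 𝓝[>] t, e s = e t)
    {V : Fin n → EuclideanSpace ℝ (Fin d) → ℝ} {lam β K : ℝ} (hK : 1 ≤ K)
    (hVc : ∀ i, Continuous (V i)) (hV : ∀ i y, ‖y‖ ≤ V i y) (hVK : ∀ i j y, V i y ≤ K * V j y)
    (hVexp : ∀ i t, 0 ≤ t → ∀ y, V i (NormedSpace.exp
      (t • Matrix.toEuclideanCLM (𝕜 := ℝ) (A i)) y) ≤ Real.exp (-lam * t) * V i y)
    (hβ0 : 0 ≤ β) (hβ : β < lam) {M : ENNReal} (hM : M ≠ ⊤)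
    (hgrowth : ∀ m : ℕ, gridGrowth (ENNReal.ofReal (K - 1)) e m
      ≤ M * ENNReal.ofReal (Real.exp (β * m))) :
    Tendsto (fun t => ‖x t‖) atTop (𝓝 0) := by
  have hfin : ∀ m : ℕ, gridGrowth (ENNReal.ofReal (K - 1)) e m ≠ ⊤ := fun m =>
    ne_top_of_le_ne_top (ENNReal.mul_ne_top hM ENNReal.ofReal_ne_top) (hgrowth m)
  have hfin' : ∀ (m : ℕ) (t : ℝ), t ≤ m → gridGrowth (ENNReal.ofReal (K - 1)) e t ≠ ⊤ :=
    fun m t ht => ne_top_of_le_ne_top (hfin m) (gridGrowth_mono _ _ ht)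
  have hV0 : ∀ i y, 0 ≤ V i y := fun i y => (norm_nonneg y).trans (hV i y)
  have hKE : (1 + ENNReal.ofReal (K - 1)).toReal = K := by
    rw [← ENNReal.ofReal_one, ← ENNReal.ofReal_add zero_le_one (by linarith),
      ENNReal.toReal_ofReal (by linarith)]
    ring
  set v0 := V (e 0) (x 0) with hv0
  have hv0' : 0 ≤ v0 := hV0 _ _
  have hbound : ∀ t, 0 ≤ t →
      ‖x t‖ ≤ M.toReal * Real.exp β * v0 * Real.exp ((β - lam) * t) := by
    intro t ht
    have hceil : (⌈t⌉₊ : ℝ) ≤ t + 1 := (Nat.ceil_lt_add_one ht).le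
    have h1 := hx.le_of_growth he (V := V) (lam := lam) (K := K) (T := ⌈t⌉₊)
      (W := fun t => (gridGrowth (ENNReal.ofReal (K - 1)) e t).toReal)
      (by linarith) hVc hV0 hVK hVexp (by simp [gridGrowth_zero])
      (fun s u _ hsu hu => ENNReal.toReal_mono (hfin' _ u hu) (gridGrowth_mono _ _ hsu))
      (fun s u hs hsu hu hne => by
        have := ENNReal.toReal_mono (hfin' _ u hu) (one_add_mul_gridGrowth_le
          (c := ENNReal.ofReal (K - 1)) ENNReal.ofReal_ne_top hs hsu (he s hs)
          (he u (hs.trans hsu)) hne)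
        rwa [ENNReal.toReal_mul, hKE] at this)
      t ⟨ht, Nat.le_ceil t⟩
    have h2 : (gridGrowth (ENNReal.ofReal (K - 1)) e t).toReal
        ≤ M.toReal * Real.exp (β * (t + 1)) := by
      have h3 := ENNReal.toReal_mono (ENNReal.mul_ne_top hM ENNReal.ofReal_ne_top)
        ((gridGrowth_mono _ _ (Nat.le_ceil t)).trans (hgrowth ⌈t⌉₊))
      rw [ENNReal.toReal_mul, ENNReal.toReal_ofReal (Real.exp_pos _).le] at h3
      refine h3.trans ?_
      gcongr
    calc ‖x t‖ ≤ V (e t) (x t) := hV _ _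
      _ ≤ _ := h1
      _ ≤ M.toReal * Real.exp (β * (t + 1)) * Real.exp (-lam * t) * v0 := by gcongr
      _ = M.toReal * v0 * (Real.exp (β * (t + 1)) * Real.exp (-lam * t)) := by ring
      _ = M.toReal * v0 * (Real.exp β * Real.exp ((β - lam) * t)) := by
          rw [← Real.exp_add, ← Real.exp_add]
          congr 2
          ring
      _ = _ := by ring
  have hlim : Tendsto (fun t : ℝ => M.toReal * Real.exp β * v0 * Real.exp ((β - lam) * t)) atTop
      (𝓝 0) := by
    have h1 : Tendsto (fun t : ℝ => (β - lam) * t) atTop atBot :=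
      tendsto_id.const_mul_atTop_of_neg (by linarith)
    simpa using (Real.tendsto_exp_atBot.comp h1).const_mul (M.toReal * Real.exp β * v0)
  exact squeeze_zero' (Eventually.of_forall fun t => norm_nonneg _)
    ((eventually_ge_atTop 0).mono hbound) hlim

theorem mainTheorem4 {n d : ℕ} (Q : Matrix (Fin n) (Fin n) ℝ) (hQ : IsGeneratorMatrix Q)
    (hirr : IsIrreducibleGenerator Q) (A : Fin n → Matrix (Fin d) (Fin d) ℝ)
    (hA : ∀ i, IsHurwitz (A i)) :
    ∃ a : ℝ, 0 < a ∧ ∀ r : ℝ, 0 < r → r < a →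
      ∀ (Ω : Type*) [MeasurableSpace Ω] (μ : Measure Ω) [IsProbabilityMeasure μ]
        (I : ℝ → Ω → Fin n) (X : ℝ → Ω → EuclideanSpace ℝ (Fin d)),
        IsMarkovProcess μ (r • Q) I →
        Integrable (X 0) μ →
        (∀ᵐ ω ∂μ, IsSwitchedSolution A (fun t => I t ω) (fun t => X t ω)) →
        ∀ᵐ ω ∂μ, Tendsto (fun t => ‖X t ω‖) atTop (𝓝 0) := by
  obtain ⟨lam, hlam, K, hK, V, hVc, hV, hVK, hVexp⟩ := exists_common_adaptedNorm hA
  obtain ⟨b, hb, hbQ⟩ := exists_one_sub_exp_smul_le Q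
  have hK1 : 0 < K - 1 := by linarith
  -- The expected growth factor has exponential rate `(K - 1) * (r * b)`, which must be less
  -- than `lam`. The bound on `a` makes it less than `lam / 2`.
  refine ⟨lam / (2 * ((K - 1) * b)), by positivity, ?_⟩
  intro r hr hra Ω _ μ _ I X hI _ hX
  have hrate : (K - 1) * (r * b) < lam / 2 := by
    rw [lt_div_iff₀ (by positivity)] at hra
    linarith
  have hG : ∀ᶠ t in 𝓝[>] (0 : ℝ), ∀ i, 1 - NormedSpace.exp (t • r • Q) i i ≤ r * b * t := by
    have hlim : Tendsto (fun t : ℝ => t * r) (𝓝[>] 0) (𝓝[>] 0) := by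
      refine tendsto_nhdsWithin_iff.2 ⟨?_, ?_⟩
      · have : Continuous fun t : ℝ => t * r := by fun_prop
        simpa using (this.tendsto 0).mono_left nhdsWithin_le_nhds
      · filter_upwards [self_mem_nhdsWithin] with t ht using mul_pos ht hr
    filter_upwards [hlim.eventually hbQ] with t ht i
    rw [smul_smul]
    exact (ht i).trans (le_of_eq (by ring))
  have hgrowth := ae_exists_le_mul_exp
    (fun m : ℕ => (hI.measurable_gridGrowth (ENNReal.ofReal (K - 1)) m).aemeasurable) hrate
    (hI.lintegral_gridGrowth_le (by positivity) hK1.le hG)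
  filter_upwards [hgrowth, hX, hI.right_continuous] with ω ⟨M, hM, hW⟩ hx he
  exact hx.tendsto_norm_zero he hK.le hVc hV hVK hVexp (by positivity) (by linarith) hM hW
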